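/- Let $H$ be a locally finite simple graph with vertex set $W$ and let $\Lambda\subset W$ be finite, such that every vertex of $\Lambda$ is joined by a path of $H$ to a vertex outside $\Lambda$. (Examples: a finite subset $\Lambda$ of an infinite lattice $H$; or a finite connected graph $H$ with a root, $\Lambda$ being all vertices except the root.) Let $E$ be the set of edges of $H$ with at least one endpoint in $\Lambda$, and for $v\in W$ let $E_v=\{e\in E: v\in e\}$ and $\deg(v)=|E_v|$, which for $v\in\Lambda$ is the degree of $v$ in $H$. Let $T\subseteq E$ be the uniform spanning tree with wired boundary, i.e. a uniformly chosen spanning tree of the multigraph that arises from $(W,E)$ by contracting $W\setminus\Lambda$ to a single vertex, and let $D_v=\sum_{e\in E_v}\mathbf 1_{\{e\in T\}}$. Let $\Omega$ be the real Grassmann algebra generated by the anticommuting variables $\psi_v,\bar\psi_v$, $v\in\Lambda$, and put $\psi_v=\bar\psi_v=0$ for $v\notin\Lambda$. Let $\Delta_\Lambda$ be the Dirichlet Laplacian, i.e. the matrix indexed by $\Lambda$ with $\Delta_\Lambda(v,v)=-\deg(v)$, $\Delta_\Lambda(u,v)=1$ if $u\sim v$, and $0$ otherwise. The fermionic Gaussian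 free field state is the linear map $\langle\cdot\rangle:\Omega\to\mathbb R$, $$\langle F\rangle=\frac1{\det(-\Delta_\Lambda)}\Big(\prod_{v\in\Lambda}\partial_{\bar\psi_v}\partial_{\psi_v}\Big)\exp\Big(\sum_{u,v\in\Lambda}(-\Delta_\Lambda)(u,v)\,\psi_u\bar\psi_v\Big)F ,$$ where $\partial_\xi$ denotes the (left) Grassmann derivative. For an edge $e=\{u,w\}$ put $\zeta(e)=(\psi_w-\psi_u)(\bar\psi_w-\bar\psi_u)$; this does not depend on the orientation of $e$, and the $\zeta(e)$ commute. For $v\in W$ and $k\ge1$ let $$X_v^{(k)}=\sum_{S\subseteq E_v,\ |S|=k}\ \prod_{e\in S}\zeta(e),\qquad Y_v=\prod_{e\in E_v}\big(1-\zeta(e)\big).$$ Theorem. Let $V\subset W$ be a finite good set, i.e. no two vertices of $V$ are neighbours in $H$, and let $k_v\in\{1,\dots,\deg(v)\}$ for every $v\in V$. Then $$\mathbb P\big(D_v=k_v\ \text{for all } v\in V\big)=\mathbb E\Big[\prod_{v\in V}\mathbf 1_{\{D_v=k_v\}}\Big]=\Big\langle \prod_{v\in V}X_v^{(k_v)}\,Y_v\Big\rangle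 .$$ -/

import Mathlib

open scoped BigOperators

namespace FermionicUST

/-! ### Graphs, wired boundary and the uniform spanning tree

`H` is a locally finite simple graph and `Λ` a finite set of its vertices.
For a finite subset `Λ` of a lattice, `H` is the lattice. For a finite connected graph with a
chosen root, `H` is that graph and `Λ` is the set of all vertices other than the root. -/

section Graph

variable {W : Type*} [DecidableEq W] (H : SimpleGraph W) [H.LocallyFinite] (Λ : Finset W)

/-- The (unoriented) edges of `H` with at least one endpoint in `Λ`. -/
def edges : Finset (Sym2 W) := Λ.biUnion fun v => H.incidenceFinset v

/-- `E_v`: the edges (with at least one endpoint in `Λ`) that are incident to `v`. -/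
def edgesAt (v : W) : Finset (Sym2 W) := (edges H Λ).filter fun e => v ∈ e

/-- For `v ∈ Λ`, the set `E_v` consists of all the edges of `H` at `v`. -/
theorem edgesAt_eq_incidenceFinset {v : W} (hv : v ∈ Λ) :
    edgesAt H Λ v = H.incidenceFinset v := by
  ext e
  simp only [edgesAt, edges, Finset.mem_filter, Finset.mem_biUnion,
    SimpleGraph.mem_incidenceFinset, SimpleGraph.incidenceSet, Set.mem_sep_iff]
  exact ⟨fun ⟨⟨_, _, h, _⟩, h'⟩ => ⟨h, h'⟩, fun h => ⟨⟨v, hv, h⟩, h.2⟩⟩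

/-- For `v ∈ Λ`, the cardinality of `E_v` is the degree of `v` in `H`. -/
theorem card_edgesAt {v : W} (hv : v ∈ Λ) : (edgesAt H Λ v).card = H.degree v := by
  rw [edgesAt_eq_incidenceFinset H Λ hv, SimpleGraph.card_incidenceFinset_eq_degree]

/-- The map that contracts all the vertices outside `Λ` to a single vertex `none`. -/
def wire (v : W) : Option {v // v ∈ Λ} := if h : v ∈ Λ then some ⟨v, h⟩ else none

/-- `T` is (the edge set of) a spanning tree of the multigraph obtained from `(W, edges H Λ)` by
contracting the complement of `Λ` to a single vertex: `T` has no two edges that are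
parallel after the contraction, and the simple graph that it forms is a tree on all the vertices
`Λ ∪ {none}`. No edge in `edges H Λ` becomes a loop. -/
def IsSpanningTree (T : Finset (Sym2 W)) : Prop :=
  T ⊆ edges H Λ ∧
  Set.InjOn (Sym2.map (wire Λ)) (T : Set (Sym2 W)) ∧
  (SimpleGraph.fromEdgeSet (Sym2.map (wire Λ) '' (T : Set (Sym2 W)))).IsTree

/-- The type of spanning trees. -/
def SpanningTree : Type _ := {T : Finset (Sym2 W) // IsSpanningTree H Λ T}

instance : MeasurableSpace (SpanningTree H Λ) := ⊤

instance : Finite (SpanningTree H Λ) :=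
  Finite.of_injective
    (fun T : SpanningTree H Λ => (⟨T.1, Finset.mem_powerset.2 T.2.1⟩ : (edges H Λ).powerset))
    fun _ _ h => Subtype.ext (congrArg (fun x : (edges H Λ).powerset => x.1) h)

/-- The law of the uniform spanning tree. -/
noncomputable def ust : MeasureTheory.Measure (SpanningTree H Λ) :=
  ProbabilityTheory.uniformOn Set.univ

/-- `D_v = ∑_{e ∈ E_v} 1_{e ∈ T}`. -/
def treeDegree (T : SpanningTree H Λ) (v : W) : ℕ :=
  ∑ e ∈ edgesAt H Λ v, if e ∈ T.1 then 1 else 0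

/-- `δ_v^{(k)} = 1_{D_v = k}`. -/
def degreeIndicator (v : W) (k : ℕ) (T : SpanningTree H Λ) : ℝ :=
  if treeDegree H Λ T v = k then 1 else 0

/-- A good set: no two of its vertices are neighbours. -/
def IsGoodSet {W : Type*} (H : SimpleGraph W) (V : Finset W) : Prop :=
  ∀ u ∈ V, ∀ v ∈ V, ¬ H.Adj u v

variable [DecidableRel H.Adj]

/-- The graph Laplacian `Δ(u, v)`. -/
def laplacian (u v : W) : ℝ :=
  if u = v then -(H.degree u : ℝ) else if H.Adj u v then 1 else 0

/-- `Δ_Λ`: the restriction of `Δ` to `Λ` (Dirichlet boundary conditions). -/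
def laplacianOn : Matrix {v // v ∈ Λ} {v // v ∈ Λ} ℝ :=
  Matrix.of fun u v => laplacian H u.1 v.1

end Graph

/-! ### The Grassmann algebra and the fermionic Gaussian free field -/

section Grassmann

variable {W : Type*} (Λ : Finset W)

/-- The real vector space spanned by the letters `ψ_v` (index `Sum.inl v`) and `ψ̄_v`
(index `Sum.inr v`), `v ∈ Λ`. -/
abbrev Letters : Type _ := {v // v ∈ Λ} ⊕ {v // v ∈ Λ} → ℝ

/-- The Grassmann algebra generated by the letters `ψ_v, ψ̄_v`, `v ∈ Λ`. -/
abbrev Grassmann : Type _ := ExteriorAlgebra ℝ (Letters Λ)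

/-- The Grassmann derivative with respect to the letter of index `i`: the linear map with
`∂_i 1 = 0` and `∂_i (ξ_j F) = δ_{ij} F - ξ_j ∂_i F`. -/
noncomputable def grassmannDeriv (i : {v // v ∈ Λ} ⊕ {v // v ∈ Λ}) : Module.End ℝ (Grassmann Λ) :=
  CliffordAlgebra.contractLeft (LinearMap.proj i : Letters Λ →ₗ[ℝ] ℝ)

theorem grassmannDeriv_one (i : {v // v ∈ Λ} ⊕ {v // v ∈ Λ}) : grassmannDeriv Λ i 1 = 0 :=
  CliffordAlgebra.contractLeft_one (Q := (0 : QuadraticForm ℝ (Letters Λ)))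
    (LinearMap.proj i : Letters Λ →ₗ[ℝ] ℝ)

theorem grassmannDeriv_ι_mul [DecidableEq W] (i j : {v // v ∈ Λ} ⊕ {v // v ∈ Λ}) (F : Grassmann Λ) :
    grassmannDeriv Λ i (ExteriorAlgebra.ι ℝ (Pi.single j 1 : Letters Λ) * F) =
      (if i = j then F else 0) -
        ExteriorAlgebra.ι ℝ (Pi.single j 1 : Letters Λ) * grassmannDeriv Λ i F := by
  have h := CliffordAlgebra.contractLeft_ι_mul (Q := (0 : QuadraticForm ℝ (Letters Λ)))
    (d := (LinearMap.proj i : Letters Λ →ₗ[ℝ] ℝ)) (a := Pi.single j 1) (b := F)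
  refine h.trans ?_
  by_cases hij : i = j
  · subst hij; simp [grassmannDeriv, ExteriorAlgebra.ι]
  · simp [grassmannDeriv, ExteriorAlgebra.ι, hij]

theorem grassmannDeriv_comm (i j : {v // v ∈ Λ} ⊕ {v // v ∈ Λ}) (F : Grassmann Λ) :
    grassmannDeriv Λ i (grassmannDeriv Λ j F) = -grassmannDeriv Λ j (grassmannDeriv Λ i F) :=
  CliffordAlgebra.contractLeft_comm (Q := (0 : QuadraticForm ℝ (Letters Λ))) _ _ F

theorem derivPair_commute (u v : {v // v ∈ Λ}) :
    Commute (grassmannDeriv Λ (Sum.inr u) * grassmannDeriv Λ (Sum.inl u))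
      (grassmannDeriv Λ (Sum.inr v) * grassmannDeriv Λ (Sum.inl v)) := by
  have key : ∀ i j k (F : Grassmann Λ), grassmannDeriv Λ i (grassmannDeriv Λ j (grassmannDeriv Λ k F)) =
      grassmannDeriv Λ k (grassmannDeriv Λ i (grassmannDeriv Λ j F)) := by
    intro i j k F
    rw [grassmannDeriv_comm Λ j k, map_neg, grassmannDeriv_comm Λ i k, neg_neg]
  refine LinearMap.ext fun F => ?_
  change grassmannDeriv Λ _ (grassmannDeriv Λ _ (grassmannDeriv Λ _ (grassmannDeriv Λ _ F))) =
    grassmannDeriv Λ _ (grassmannDeriv Λ _ (grassmannDeriv Λ _ (grassmannDeriv Λ _ F)))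
  rw [key (Sum.inr u) (Sum.inl u) (Sum.inr v), key (Sum.inr u) (Sum.inl u) (Sum.inl v)]

/-- The operator `∏_{v ∈ Λ} ∂_{ψ̄_v} ∂_{ψ_v}`. The factors commute with each other. -/
noncomputable def berezin : Module.End ℝ (Grassmann Λ) :=
  Finset.univ.noncommProd
    (fun v : {v // v ∈ Λ} => grassmannDeriv Λ (Sum.inr v) * grassmannDeriv Λ (Sum.inl v))
    fun u _ v _ _ => derivPair_commute Λ u v

variable [DecidableEq W]

/-- The generator `ψ_v`, which is `0` outside `Λ`. -/
noncomputable def psi (v : W) : Grassmann Λ :=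
  ExteriorAlgebra.ι ℝ (if h : v ∈ Λ then Pi.single (Sum.inl ⟨v, h⟩) 1 else 0 : Letters Λ)

/-- The generator `ψ̄_v`, which is `0` outside `Λ`. -/
noncomputable def psiBar (v : W) : Grassmann Λ :=
  ExteriorAlgebra.ι ℝ (if h : v ∈ Λ then Pi.single (Sum.inr ⟨v, h⟩) 1 else 0 : Letters Λ)

/-- The bilinear form `(ψ, A ψ̄) = ∑_{u, v ∈ Λ} A(u, v) ψ_u ψ̄_v`. -/
noncomputable def bilin (A : Matrix {v // v ∈ Λ} {v // v ∈ Λ} ℝ) : Grassmann Λ :=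
  ∑ u, ∑ v, A u v • (psi Λ u.1 * psiBar Λ v.1)

/-- The normalized fermionic Gaussian free field state
`F ↦ det(-Δ_Λ)⁻¹ (∏_{v ∈ Λ} ∂_{ψ̄_v} ∂_{ψ_v}) (exp((ψ, -Δ_Λ ψ̄)) F)`. After all the
derivatives a scalar is left; `algebraMapInv` reads it as a real number. The exponent is nilpotent,
so that its exponential is a finite sum. -/
noncomputable def fgff {W : Type*} [DecidableEq W] (H : SimpleGraph W) [H.LocallyFinite]
    [DecidableRel H.Adj] (Λ : Finset W) :
    Grassmann Λ →ₗ[ℝ] ℝ :=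
  ((-laplacianOn H Λ).det)⁻¹ •
    ((ExteriorAlgebra.algebraMapInv (R := ℝ) (M := Letters Λ)).toLinearMap ∘ₗ berezin Λ ∘ₗ
      LinearMap.mulLeft ℝ (IsNilpotent.exp (bilin Λ (-laplacianOn H Λ))))

/-- A product of two elements of degree one commutes with every element. -/
theorem ι_mul_ι_mem_center {M : Type*} [AddCommGroup M] [Module ℝ M] (a b : M) :
    ExteriorAlgebra.ι ℝ a * ExteriorAlgebra.ι ℝ b ∈
      Subalgebra.center ℝ (ExteriorAlgebra ℝ M) := by
  rw [Subalgebra.mem_center_iff]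
  intro x
  have swap : ∀ m n : M, ExteriorAlgebra.ι ℝ m * ExteriorAlgebra.ι ℝ n =
      -(ExteriorAlgebra.ι ℝ n * ExteriorAlgebra.ι ℝ m) := fun m n =>
    eq_neg_of_add_eq_zero_left (ExteriorAlgebra.ι_add_mul_swap m n)
  induction x using ExteriorAlgebra.induction with
  | algebraMap r => exact Algebra.commutes r _
  | ι m =>
    rw [← mul_assoc, swap m a, neg_mul, mul_assoc, swap m b, mul_neg, neg_neg, mul_assoc]
  | mul y z hy hz => rw [mul_assoc, hz, ← mul_assoc, hy, mul_assoc]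
  | add y z hy hz => rw [add_mul, mul_add, hy, hz]

/-- `ζ(e) = (ψ_w - ψ_u) (ψ̄_w - ψ̄_u)` for an edge `e = {u, w}`; it does not depend on the
orientation of `e`. It is even, hence central, and it is regarded as an element of the
(commutative) center of the Grassmann algebra, so that products need no order. -/
noncomputable def zeta : Sym2 W → Subalgebra.center ℝ (Grassmann Λ) :=
  Sym2.lift ⟨fun u w => ⟨(psi Λ w - psi Λ u) * (psiBar Λ w - psiBar Λ u), by
      simp only [psi, psiBar, ← map_sub]
      exact ι_mul_ι_mem_center _ _⟩,
    fun u w => Subtype.ext (by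
      change (psi Λ w - psi Λ u) * (psiBar Λ w - psiBar Λ u) =
        (psi Λ u - psi Λ w) * (psiBar Λ u - psiBar Λ w)
      rw [← neg_sub (psi Λ u), ← neg_sub (psiBar Λ u), neg_mul_neg])⟩

/-- `X_v^{(k)} = ∑_{S ⊆ E_v, |S| = k} ∏_{e ∈ S} ζ(e)`. -/
noncomputable def fieldX {W : Type*} [DecidableEq W] (H : SimpleGraph W) [H.LocallyFinite]
    (Λ : Finset W) (k : ℕ) (v : W) : Subalgebra.center ℝ (Grassmann Λ) :=
  ∑ S ∈ (edgesAt H Λ v).powersetCard k, ∏ e ∈ S, zeta Λ e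

/-- `Y_v = ∏_{e ∈ E_v} (1 - ζ(e))`. -/
noncomputable def fieldY {W : Type*} [DecidableEq W] (H : SimpleGraph W) [H.LocallyFinite]
    (Λ : Finset W) (v : W) : Subalgebra.center ℝ (Grassmann Λ) :=
  ∏ e ∈ edgesAt H Λ v, (1 - zeta Λ e)

end Grassmann

end FermionicUST

/-! The theorem is a generating function identity in the center of the Grassmann algebra, a
commutative ring that contains the fields `ζ(e)`. The Gaussian weight factorizes over the edges,
`exp((ψ, -Δ_Λ ψ̄)) = ∏_{e ∈ E} (1 + ζ(e))` (`exp_bilin_neg_laplacianOn`), because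
`(ψ, -Δ_Λ ψ̄) = ∑_e ζ(e)` and `ζ(e)² = 0`. Expanding the product, the whole claim rests on the
Berezin integrals of the products `∏_{e ∈ A} ζ(e)`, `A ⊆ E`: such an integral is `1` if `A` is a
spanning tree and `0` otherwise (`berezinIntegral_prod_zeta`).

* If `A` does not connect some set `C ⊆ Λ` of vertices to the wired boundary, then
  `∑_{v ∈ C} ∂_{ψ_v}` kills every gradient along `A`, hence the product; and the Berezin integral
  can be written with this derivative in place of one `∂_{ψ_v}`, `v ∈ C`
  (`berezinIntegral_prod_zeta_of_not_connected`).
* If `A` is connected, then exploring the wired graph from the boundary yields `F ⊆ A` with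
  `|F| = |Λ|` and `∏_{e ∈ F} ζ(e) = ∏_{v ∈ Λ} ψ_v ψ̄_v` (`exists_exploration`), whose integral is
  `1`. Further edges multiply this top element to zero, and there are none exactly if `A` is a tree
  (`isSpanningTree_iff_card`).

The normalization `det(-Δ_Λ)` is the Gaussian integral itself (`det_neg_laplacianOn`), as
`∫ exp((ψ, A ψ̄))` is an alternating function of the rows of `A`; so it is the number of spanning
trees.

Finally, the sets `E_v`, `v ∈ V`, are disjoint since `V` is good, and `(1 - ζ)(1 + ζ) = 1`. Thus
`Y_v` cancels the Gaussian weight on `E_v`, and what remains,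
`∏_{e ∉ ⋃ E_v} (1 + ζ(e)) ∏_v X_v^{(k_v)}`, is the sum of `∏_{e ∈ A} ζ(e)` over the `A ⊆ E` with
`|A ∩ E_v| = k_v` for all `v ∈ V` (`prod_one_add_mul_prod_one_sub`,
`sum_prod_filter_card_inter`). Its integral counts the spanning trees with the prescribed degrees.
-/

namespace FermionicUST

/-! ### Products of two letters, derivatives and the Berezin integral -/

section Pairs

variable {W : Type*} (Λ : Finset W)

/-- The center of the Grassmann algebra, a commutative ring in which products of two letters
live. -/
abbrev Center : Type _ := Subalgebra.center ℝ (Grassmann Λ)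

/-- The product of two elements of degree one, as a bilinear map into the center. -/
noncomputable def pair : Letters Λ →ₗ[ℝ] Letters Λ →ₗ[ℝ] Center Λ :=
  LinearMap.mk₂ ℝ
    (fun a b => ⟨ExteriorAlgebra.ι ℝ a * ExteriorAlgebra.ι ℝ b, ι_mul_ι_mem_center a b⟩)
    (fun a b c => Subtype.ext (by simp [add_mul]))
    (fun r a b => Subtype.ext (by simp))
    (fun a b c => Subtype.ext (by simp [mul_add]))
    (fun r a b => Subtype.ext (by simp))

theorem coe_pair (a b : Letters Λ) :
    (pair Λ a b : Grassmann Λ) = ExteriorAlgebra.ι ℝ a * ExteriorAlgebra.ι ℝ b := rfl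

theorem pair_sub_left (a b c : Letters Λ) : pair Λ (a - b) c = pair Λ a c - pair Λ b c :=
  LinearMap.map_sub₂ _ _ _ _

theorem pair_sub_right (a b c : Letters Λ) : pair Λ a (b - c) = pair Λ a b - pair Λ a c :=
  map_sub _ _ _

theorem pair_sub_left_mul (a b c : Letters Λ) (F : Center Λ) :
    pair Λ (a - b) c * F = pair Λ a c * F - pair Λ b c * F := by
  rw [pair_sub_left]
  exact sub_mul _ _ _

theorem pair_sub_right_mul (a b c : Letters Λ) (F : Center Λ) :
    pair Λ a (b - c) * F = pair Λ a b * F - pair Λ a c * F := by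
  rw [pair_sub_right]
  exact sub_mul _ _ _

theorem ι_mul_swap (a b : Letters Λ) :
    ExteriorAlgebra.ι ℝ a * ExteriorAlgebra.ι ℝ b =
      -(ExteriorAlgebra.ι ℝ b * ExteriorAlgebra.ι ℝ a) :=
  eq_neg_of_add_eq_zero_left (ExteriorAlgebra.ι_add_mul_swap a b)

theorem pair_mul_pair_same_left (a b c : Letters Λ) : pair Λ a b * pair Λ a c = 0 := by
  refine Subtype.ext ?_
  change ExteriorAlgebra.ι ℝ a * ExteriorAlgebra.ι ℝ b *
    (ExteriorAlgebra.ι ℝ a * ExteriorAlgebra.ι ℝ c) = 0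
  rw [ι_mul_swap Λ a b, neg_mul, mul_assoc, ← mul_assoc (ExteriorAlgebra.ι ℝ a),
    ExteriorAlgebra.ι_sq_zero, zero_mul, mul_zero, neg_zero]

theorem pair_mul_pair_same_right (a b c : Letters Λ) : pair Λ a c * pair Λ b c = 0 := by
  refine Subtype.ext ?_
  change ExteriorAlgebra.ι ℝ a * ExteriorAlgebra.ι ℝ c *
    (ExteriorAlgebra.ι ℝ b * ExteriorAlgebra.ι ℝ c) = 0
  rw [ι_mul_swap Λ b c, mul_neg, mul_assoc, ← mul_assoc (ExteriorAlgebra.ι ℝ c),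
    ExteriorAlgebra.ι_sq_zero, zero_mul, mul_zero, neg_zero]

theorem contractLeft_ι_mul (d : Letters Λ →ₗ[ℝ] ℝ) (a : Letters Λ) (F : Grassmann Λ) :
    CliffordAlgebra.contractLeft (Q := (0 : QuadraticForm ℝ (Letters Λ))) d
        (ExteriorAlgebra.ι ℝ a * F) =
      d a • F - ExteriorAlgebra.ι ℝ a * CliffordAlgebra.contractLeft d F :=
  CliffordAlgebra.contractLeft_ι_mul (Q := (0 : QuadraticForm ℝ (Letters Λ))) _ _ _

theorem contractLeft_pair_mul (d : Letters Λ →ₗ[ℝ] ℝ) {a b : Letters Λ} (ha : d a = 0)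
    (hb : d b = 0) (F : Grassmann Λ) :
    CliffordAlgebra.contractLeft (Q := (0 : QuadraticForm ℝ (Letters Λ))) d
        ((pair Λ a b : Grassmann Λ) * F) =
      (pair Λ a b : Grassmann Λ) * CliffordAlgebra.contractLeft d F := by
  rw [coe_pair, mul_assoc, contractLeft_ι_mul, contractLeft_ι_mul, ha, hb, zero_smul, zero_smul,
    zero_sub, zero_sub, mul_neg, neg_neg, mul_assoc]

/-- A derivative that kills all the letters of a product kills the product. -/
theorem contractLeft_prod_pair {ι : Type*} (d : Letters Λ →ₗ[ℝ] ℝ) (s : Finset ι)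
    (a b : ι → Letters Λ) (ha : ∀ i ∈ s, d (a i) = 0) (hb : ∀ i ∈ s, d (b i) = 0) :
    CliffordAlgebra.contractLeft (Q := (0 : QuadraticForm ℝ (Letters Λ))) d
        ((∏ i ∈ s, pair Λ (a i) (b i) : Center Λ) : Grassmann Λ) = 0 := by
  classical
  induction s using Finset.induction_on with
  | empty =>
    rw [Finset.prod_empty]
    exact CliffordAlgebra.contractLeft_one (Q := (0 : QuadraticForm ℝ (Letters Λ))) d
  | insert i s hi ih =>
    rw [Finset.prod_insert hi, MulMemClass.coe_mul,
      contractLeft_pair_mul Λ d (ha i (by simp)) (hb i (by simp)),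
      ih (fun j hj => ha j (by simp [hj])) (fun j hj => hb j (by simp [hj])), mul_zero]

theorem grassmannDeriv_sq (i : {v // v ∈ Λ} ⊕ {v // v ∈ Λ}) (F : Grassmann Λ) :
    grassmannDeriv Λ i (grassmannDeriv Λ i F) = 0 :=
  CliffordAlgebra.contractLeft_contractLeft (Q := (0 : QuadraticForm ℝ (Letters Λ))) _ _

/-- The operator `∏_{v ∈ s} ∂_{ψ̄_v} ∂_{ψ_v}`. -/
noncomputable def derivProd (s : Finset {v // v ∈ Λ}) : Module.End ℝ (Grassmann Λ) :=
  s.noncommProd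
    (fun v : {v // v ∈ Λ} => grassmannDeriv Λ (Sum.inr v) * grassmannDeriv Λ (Sum.inl v))
    fun u _ v _ _ => derivPair_commute Λ u v

theorem berezin_eq_derivProd : berezin Λ = derivProd Λ Finset.univ := rfl

/-- The linear functional on the center that underlies the state `fgff`: the scalar part of the
Berezin integral. -/
noncomputable def berezinIntegral : Center Λ →ₗ[ℝ] ℝ :=
  (ExteriorAlgebra.algebraMapInv (R := ℝ) (M := Letters Λ)).toLinearMap ∘ₗ berezin Λ ∘ₗ
    (Subalgebra.center ℝ (Grassmann Λ)).val.toLinearMap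

theorem berezinIntegral_apply (F : Center Λ) :
    berezinIntegral Λ F = ExteriorAlgebra.algebraMapInv (berezin Λ (F : Grassmann Λ)) := rfl

variable [DecidableEq W]

theorem derivProd_apply {s : Finset {v // v ∈ Λ}} {v : {v // v ∈ Λ}} (hv : v ∈ s)
    (F : Grassmann Λ) :
    derivProd Λ s F = derivProd Λ (s.erase v)
      (grassmannDeriv Λ (Sum.inr v) (grassmannDeriv Λ (Sum.inl v) F)) :=
  LinearMap.congr_fun (Finset.noncommProd_erase_mul s hv _
    (fun u _ v _ _ => derivPair_commute Λ u v)).symm F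

/-- The Berezin integral of `F` vanishes if `F` does not involve the letter `ψ_v`. -/
theorem berezin_eq_zero_of_deriv (v : {v // v ∈ Λ}) (F : Grassmann Λ)
    (h : grassmannDeriv Λ (Sum.inl v) F = 0) : berezin Λ F = 0 := by
  rw [berezin_eq_derivProd, derivProd_apply Λ (Finset.mem_univ v), h, map_zero, map_zero]

/-- Replacing `∂_{ψ_v}` by another `∂_{ψ_u}` turns the Berezin integral into zero, since then
`∂_{ψ_u}` occurs twice. -/
theorem berezin_replace {u v : {v // v ∈ Λ}} (huv : u ≠ v) (F : Grassmann Λ) :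
    derivProd Λ (Finset.univ.erase v)
      (grassmannDeriv Λ (Sum.inr v) (grassmannDeriv Λ (Sum.inl u) F)) = 0 := by
  rw [derivProd_apply Λ (Finset.mem_erase.2 ⟨huv, Finset.mem_univ u⟩),
    grassmannDeriv_comm Λ (Sum.inl u), grassmannDeriv_sq, map_zero, neg_zero, map_zero, map_zero]

/-- The Berezin integral may be carried out in coordinates in which `∂_{ψ_v}` is replaced by the
sum of the `∂_{ψ_u}`, `u ∈ C`. -/
theorem berezin_eq_zero_of_sum_deriv (C : Finset {v // v ∈ Λ}) (hC : C.Nonempty)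
    (F : Grassmann Λ) (h : ∑ v ∈ C, grassmannDeriv Λ (Sum.inl v) F = 0) : berezin Λ F = 0 := by
  obtain ⟨v, hv⟩ := hC
  rw [← Finset.add_sum_erase _ _ hv] at h
  rw [berezin_eq_derivProd, derivProd_apply Λ (Finset.mem_univ v),
    eq_neg_of_add_eq_zero_left h, map_neg, map_neg, map_sum, map_sum, neg_eq_zero]
  exact Finset.sum_eq_zero fun u hu => berezin_replace Λ (Finset.ne_of_mem_erase hu) F

/-- The vector `ψ_v` of the space of letters. -/
noncomputable def letter (v : {v // v ∈ Λ}) : Letters Λ := Pi.single (Sum.inl v) 1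

/-- The vector `ψ̄_v` of the space of letters. -/
noncomputable def letterBar (v : {v // v ∈ Λ}) : Letters Λ := Pi.single (Sum.inr v) 1

/-- `ψ_v ψ̄_v`. -/
noncomputable def density (v : {v // v ∈ Λ}) : Center Λ := pair Λ (letter Λ v) (letterBar Λ v)

/-- If `F` involves neither `ψ_v` nor `ψ̄_v`, then `∂_{ψ̄_v} ∂_{ψ_v}` strips `ψ_v ψ̄_v` off
`ψ_v ψ̄_v F`, with sign `+1`. -/
theorem derivPair_density_mul (v : {v // v ∈ Λ}) (F : Grassmann Λ)
    (hl : grassmannDeriv Λ (Sum.inl v) F = 0) (hr : grassmannDeriv Λ (Sum.inr v) F = 0) :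
    grassmannDeriv Λ (Sum.inr v) (grassmannDeriv Λ (Sum.inl v) (density Λ v * F)) = F := by
  rw [density, coe_pair, mul_assoc, letter, grassmannDeriv_ι_mul, letterBar,
    grassmannDeriv_ι_mul, hl]
  simp [grassmannDeriv_ι_mul, hr]

theorem derivProd_prod_density (s : Finset {v // v ∈ Λ}) :
    derivProd Λ s ((∏ v ∈ s, density Λ v : Center Λ) : Grassmann Λ) = 1 := by
  induction s using Finset.induction_on with
  | empty => rfl
  | insert v s hv ih =>
    rw [derivProd_apply Λ (Finset.mem_insert_self v s), Finset.erase_insert hv,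
      Finset.prod_insert hv, MulMemClass.coe_mul, derivPair_density_mul, ih]
    all_goals
      refine contractLeft_prod_pair Λ _ s _ _ (fun u hu => ?_) (fun u hu => ?_) <;>
      · have : v ≠ u := fun h => hv (h ▸ hu)
        simp [letter, letterBar, this]

theorem berezinIntegral_prod_density : berezinIntegral Λ (∏ v, density Λ v) = 1 := by
  rw [berezinIntegral_apply, berezin_eq_derivProd, derivProd_prod_density, map_one]

end Pairs

/-! ### The Gaussian integral is a determinant -/

section Gaussian

variable {W : Type*} (Λ : Finset W)

/-- The exponential of a sum of commuting elements of square zero. -/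
theorem exp_sum_of_sq_zero {A ι : Type*} [Ring A] [Algebra ℝ A] [Module ℚ A] (s : Finset ι)
    (f : ι → Subalgebra.center ℝ A) (hf : ∀ i ∈ s, f i * f i = 0) :
    IsNilpotent.exp ((∑ i ∈ s, f i : Subalgebra.center ℝ A) : A) =
        ((∏ i ∈ s, (1 + f i) : Subalgebra.center ℝ A) : A) ∧
      IsNilpotent ((∑ i ∈ s, f i : Subalgebra.center ℝ A) : A) := by
  classical
  induction s using Finset.induction_on with
  | empty => simp [IsNilpotent.exp_zero]
  | insert i s hi ih =>
    obtain ⟨h1, h2⟩ := ih fun j hj => hf j (by simp [hj])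
    have hsq : (f i : A) ^ 2 = 0 := by
      rw [sq, ← MulMemClass.coe_mul, hf i (by simp)]; rfl
    have hn : IsNilpotent (f i : A) := ⟨2, hsq⟩
    have hc : Commute (f i : A) ((∑ i ∈ s, f i : Subalgebra.center ℝ A) : A) :=
      (Subalgebra.mem_center_iff.1 (f i).2 _).symm
    rw [Finset.sum_insert hi, Finset.prod_insert hi, AddMemClass.coe_add]
    refine ⟨?_, hc.isNilpotent_add hn h2⟩
    rw [IsNilpotent.exp_add_of_commute hc hn h2, h1, IsNilpotent.exp_eq_sum hsq]
    simp [Finset.sum_range_succ]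

variable [DecidableEq W]

/-- `∑_v r_v ψ̄_v`, for a row `r` of a matrix. -/
noncomputable def rowBar : ({v // v ∈ Λ} → ℝ) →ₗ[ℝ] Letters Λ :=
  Fintype.linearCombination ℝ (letterBar Λ)

/-- `M ↦ ∫ ∏_u ψ_u (∑_v M(u, v) ψ̄_v)`, an alternating function of the rows of `M`. -/
noncomputable def rowIntegral : ({v // v ∈ Λ} → ℝ) [⋀^{v // v ∈ Λ}]→ₗ[ℝ] ℝ :=
  { (berezinIntegral Λ).compMultilinearMap
      ((MultilinearMap.mkPiAlgebra ℝ {v // v ∈ Λ} (Center Λ)).compLinearMap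
        fun u => (pair Λ (letter Λ u)).comp (rowBar Λ)) with
    map_eq_zero_of_eq' := fun M u v huv hne => by
      change berezinIntegral Λ (∏ u, pair Λ (letter Λ u) (rowBar Λ (M u))) = 0
      rw [← Finset.mul_prod_erase _ _ (Finset.mem_univ u), ← Finset.mul_prod_erase _ _
        (Finset.mem_erase.2 ⟨hne.symm, Finset.mem_univ v⟩), ← mul_assoc, huv,
        pair_mul_pair_same_right, zero_mul, map_zero] }

theorem rowIntegral_apply (M : Matrix {v // v ∈ Λ} {v // v ∈ Λ} ℝ) :
    rowIntegral Λ M = berezinIntegral Λ (∏ u, pair Λ (letter Λ u) (rowBar Λ (M u))) := rfl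

theorem rowIntegral_eq_det (M : Matrix {v // v ∈ Λ} {v // v ∈ Λ} ℝ) :
    rowIntegral Λ M = M.det := by
  have h1 : rowIntegral Λ (Pi.basisFun ℝ {v // v ∈ Λ}) = 1 := by
    rw [← berezinIntegral_prod_density Λ]
    change berezinIntegral Λ _ = _
    congr 1
    refine Finset.prod_congr rfl fun u _ => ?_
    change pair Λ (letter Λ u) (rowBar Λ (Pi.basisFun ℝ _ u)) = _
    rw [density, rowBar, Pi.basisFun_apply, Fintype.linearCombination_apply_single, one_smul]
  rw [(rowIntegral Λ).eq_smul_basis_det (Pi.basisFun ℝ {v // v ∈ Λ}), h1, one_smul,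
    Pi.basisFun_det]
  rfl

theorem bilin_eq_sum (A : Matrix {v // v ∈ Λ} {v // v ∈ Λ} ℝ) :
    bilin Λ A = ((∑ u, pair Λ (letter Λ u) (rowBar Λ (A u)) : Center Λ) : Grassmann Λ) := by
  rw [AddSubmonoidClass.coe_finsetSum, bilin]
  refine Finset.sum_congr rfl fun u _ => ?_
  rw [rowBar, Fintype.linearCombination_apply, map_sum, AddSubmonoidClass.coe_finsetSum]
  refine Finset.sum_congr rfl fun v _ => ?_
  simp [psi, psiBar, coe_pair, letter, letterBar]

/-- The fermionic Gaussian integral: `∫ exp((ψ, A ψ̄)) = det A`. -/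
theorem berezinIntegral_prod_one_add_row (A : Matrix {v // v ∈ Λ} {v // v ∈ Λ} ℝ) :
    berezinIntegral Λ (∏ u, (1 + pair Λ (letter Λ u) (rowBar Λ (A u)))) = A.det := by
  rw [Finset.prod_one_add, map_sum, Finset.sum_eq_single Finset.univ, ← rowIntegral_eq_det,
    rowIntegral_apply]
  · intro U _ hU
    -- A letter `ψ_v` with `v ∉ U` is missing in the product over `U`.
    obtain ⟨v, hv⟩ : ∃ v, v ∉ U := by
      by_contra! h
      exact hU (Finset.eq_univ_iff_forall.2 h)
    rw [berezinIntegral_apply, berezin_eq_zero_of_deriv Λ v, map_zero]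
    refine contractLeft_prod_pair Λ _ U _ _ (fun u hu => ?_) (fun u hu => ?_)
    · have : v ≠ u := fun h => hv (h ▸ hu)
      simp [letter, this]
    · simp [rowBar, Fintype.linearCombination_apply, letterBar]
  · simp

end Gaussian

/-! ### The edge fields and the Dirichlet Laplacian -/

section Edges

variable {W : Type*} [DecidableEq W] (Λ : Finset W)

/-- The vector `ψ_x` for a vertex `x` of the wired graph; it is `0` at the contracted vertex. -/
noncomputable def wiredLetter (x : Option {v // v ∈ Λ}) : Letters Λ := x.elim 0 (letter Λ)

/-- The vector `ψ̄_x` for a vertex `x` of the wired graph; it is `0` at the contracted vertex. -/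
noncomputable def wiredLetterBar (x : Option {v // v ∈ Λ}) : Letters Λ := x.elim 0 (letterBar Λ)

/-- The field `ζ` on the edges of the wired graph. -/
noncomputable def wiredZeta : Sym2 (Option {v // v ∈ Λ}) → Center Λ :=
  Sym2.lift ⟨fun x y => pair Λ (wiredLetter Λ y - wiredLetter Λ x)
      (wiredLetterBar Λ y - wiredLetterBar Λ x), fun x y => by
    simp only [pair_sub_left, pair_sub_right]
    abel⟩

theorem wiredZeta_mk (x y : Option {v // v ∈ Λ}) :
    wiredZeta Λ s(x, y) = pair Λ (wiredLetter Λ y - wiredLetter Λ x)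
      (wiredLetterBar Λ y - wiredLetterBar Λ x) := rfl

theorem psi_eq (v : W) : psi Λ v = ExteriorAlgebra.ι ℝ (wiredLetter Λ (wire Λ v)) := by
  by_cases h : v ∈ Λ <;> simp [psi, wire, wiredLetter, letter, h]

theorem psiBar_eq (v : W) : psiBar Λ v = ExteriorAlgebra.ι ℝ (wiredLetterBar Λ (wire Λ v)) := by
  by_cases h : v ∈ Λ <;> simp [psiBar, wire, wiredLetterBar, letterBar, h]

theorem zeta_eq_wiredZeta (e : Sym2 W) : zeta Λ e = wiredZeta Λ (e.map (wire Λ)) := by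
  induction e with | _ u w => ?_
  refine Subtype.ext ?_
  change (psi Λ w - psi Λ u) * (psiBar Λ w - psiBar Λ u) = _
  rw [Sym2.map_mk, wiredZeta_mk, coe_pair, map_sub, map_sub]
  simp only [psi_eq, psiBar_eq]

theorem wiredZeta_mul_self (e : Sym2 (Option {v // v ∈ Λ})) :
    wiredZeta Λ e * wiredZeta Λ e = 0 := by
  induction e with | _ x y => exact pair_mul_pair_same_left Λ _ _ _

theorem zeta_mul_self (e : Sym2 W) : zeta Λ e * zeta Λ e = 0 := by
  rw [zeta_eq_wiredZeta, wiredZeta_mul_self]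

variable (H : SimpleGraph W) [H.LocallyFinite]

theorem mem_edges_mk {a b : W} : s(a, b) ∈ edges H Λ ↔ H.Adj a b ∧ (a ∈ Λ ∨ b ∈ Λ) := by
  simp only [edges, Finset.mem_biUnion, SimpleGraph.mem_incidenceFinset,
    SimpleGraph.mk'_mem_incidenceSet_iff]
  constructor
  · rintro ⟨v, hv, h, rfl | rfl⟩
    · exact ⟨h, Or.inl hv⟩
    · exact ⟨h, Or.inr hv⟩
  · rintro ⟨h, hv | hv⟩
    · exact ⟨a, hv, h, Or.inl rfl⟩
    · exact ⟨b, hv, h, Or.inr rfl⟩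

/-- Every edge `{u, w}` gives the two half-edge terms `ψ_u (ψ̄_u - ψ̄_w)` and
`ψ_w (ψ̄_w - ψ̄_u)`, and the half-edges are sorted by their first vertex. -/
theorem sum_zeta_eq_sum_neighbor :
    ∑ e ∈ edges H Λ, zeta Λ e =
      ∑ u ∈ Λ, pair Λ (wiredLetter Λ (wire Λ u)) (∑ w ∈ H.neighborFinset u,
        (wiredLetterBar Λ (wire Λ u) - wiredLetterBar Λ (wire Λ w))) := by
  simp_rw [map_sum]
  rw [Finset.sum_sigma', ← Finset.sum_fiberwise_of_maps_to (t := edges H Λ)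
    (g := fun x : (_ : W) × W => s(x.1, x.2))]
  · refine Finset.sum_congr rfl fun e he => ?_
    induction e with | _ a b => ?_
    obtain ⟨hab, -⟩ := (mem_edges_mk Λ H).1 he
    symm
    refine (Finset.sum_subset (s₂ := {⟨a, b⟩, ⟨b, a⟩}) ?_ ?_).trans ?_
    · rintro ⟨u, w⟩ hx
      have := (Finset.mem_filter.1 hx).2
      simp only [Sym2.eq_iff] at this
      rcases this with ⟨rfl, rfl⟩ | ⟨rfl, rfl⟩ <;> simp
    · rintro ⟨u, w⟩ hx hx'
      have hu : u ∉ Λ := by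
        intro hu
        refine hx' (Finset.mem_filter.2 ?_)
        simp only [Finset.mem_insert, Finset.mem_singleton, Sigma.mk.injEq, heq_eq_eq] at hx
        rcases hx with ⟨rfl, rfl⟩ | ⟨rfl, rfl⟩
        · simp [hu, hab]
        · simp [hu, hab.symm]
      simp [wire, hu, wiredLetter]
    · rw [Finset.sum_pair (by simp [hab.ne]), zeta_eq_wiredZeta, Sym2.map_mk, wiredZeta_mk]
      simp only [pair_sub_left, pair_sub_right]
      abel
  · rintro ⟨u, w⟩ hx
    rw [Finset.mem_sigma] at hx
    exact (mem_edges_mk Λ H).2 ⟨(H.mem_neighborFinset u w).1 hx.2, Or.inl hx.1⟩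

theorem wiredLetterBar_wire_eq_sum (w : W) :
    wiredLetterBar Λ (wire Λ w) =
      ∑ v : {v // v ∈ Λ}, (if w = v.1 then (1 : ℝ) else 0) • letterBar Λ v := by
  by_cases hw : w ∈ Λ
  · rw [Finset.sum_eq_single ⟨w, hw⟩]
    · simp [wire, hw, wiredLetterBar]
    · intro v _ hv
      rw [if_neg fun h => hv (Subtype.ext h.symm), zero_smul]
    · simp
  · rw [Finset.sum_eq_zero]
    · simp [wire, hw, wiredLetterBar]
    · intro v _
      rw [if_neg (fun h : w = v.1 => hw (h ▸ v.2)), zero_smul]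

variable [DecidableRel H.Adj]

theorem rowBar_neg_laplacianOn (u : {v // v ∈ Λ}) :
    rowBar Λ ((-laplacianOn H Λ) u) = ∑ w ∈ H.neighborFinset u,
      (wiredLetterBar Λ (wire Λ u) - wiredLetterBar Λ (wire Λ w)) := by
  rw [Finset.sum_sub_distrib, Finset.sum_const, SimpleGraph.card_neighborFinset_eq_degree,
    rowBar, Fintype.linearCombination_apply]
  simp_rw [wiredLetterBar_wire_eq_sum Λ]
  rw [Finset.sum_comm, Finset.smul_sum, ← Finset.sum_sub_distrib]
  refine Finset.sum_congr rfl fun v _ => ?_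
  rw [← Finset.sum_smul, Finset.sum_ite_eq', ← Nat.cast_smul_eq_nsmul ℝ, smul_smul, ← sub_smul]
  congr 1
  simp only [laplacianOn, laplacian, Matrix.neg_apply, Matrix.of_apply,
    SimpleGraph.mem_neighborFinset]
  by_cases h : u.1 = v.1
  · simp [h]
  · simp only [h, if_false]; split_ifs <;> simp

theorem sum_row_eq_sum_zeta :
    ∑ u, pair Λ (letter Λ u) (rowBar Λ ((-laplacianOn H Λ) u)) = ∑ e ∈ edges H Λ, zeta Λ e := by
  rw [sum_zeta_eq_sum_neighbor, ← Finset.sum_coe_sort Λ]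
  refine Finset.sum_congr rfl fun u _ => ?_
  rw [rowBar_neg_laplacianOn]
  simp [wire, wiredLetter]

/-- The Gaussian weight is a product over the edges. -/
theorem exp_bilin_neg_laplacianOn :
    IsNilpotent.exp (bilin Λ (-laplacianOn H Λ)) =
      ((∏ e ∈ edges H Λ, (1 + zeta Λ e) : Center Λ) : Grassmann Λ) := by
  rw [bilin_eq_sum, sum_row_eq_sum_zeta]
  exact (exp_sum_of_sq_zero _ _ fun e _ => zeta_mul_self Λ e).1

theorem det_neg_laplacianOn :
    (-laplacianOn H Λ).det = berezinIntegral Λ (∏ e ∈ edges H Λ, (1 + zeta Λ e)) := by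
  rw [← berezinIntegral_prod_one_add_row]
  congr 1
  refine Subtype.ext ?_
  rw [← exp_bilin_neg_laplacianOn, bilin_eq_sum]
  exact (exp_sum_of_sq_zero _ _ fun (u : {v // v ∈ Λ}) _ =>
    pair_mul_pair_same_left Λ (letter Λ u) _ _).1.symm

theorem fgff_coe (F : Center Λ) :
    fgff H Λ (F : Grassmann Λ) = (berezinIntegral Λ (∏ e ∈ edges H Λ, (1 + zeta Λ e)))⁻¹ *
      berezinIntegral Λ ((∏ e ∈ edges H Λ, (1 + zeta Λ e)) * F) := by
  rw [← det_neg_laplacianOn, berezinIntegral_apply, MulMemClass.coe_mul,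
    ← exp_bilin_neg_laplacianOn]
  rfl

end Edges

/-! ### Berezin integrals of edge products and spanning trees -/

section Trees

variable {W : Type*} [DecidableEq W] (Λ : Finset W)

/-- The simple graph that the edge set `A` forms after the contraction. -/
abbrev wiredGraph (A : Finset (Sym2 W)) : SimpleGraph (Option {v // v ∈ Λ}) :=
  SimpleGraph.fromEdgeSet (Sym2.map (wire Λ) '' (A : Set (Sym2 W)))

/-- If some vertices are not connected by `A` to the contracted vertex, then the sum of the
derivatives `∂_{ψ_v}` over these vertices kills all the gradients along `A`. -/
theorem berezinIntegral_prod_zeta_of_not_connected (A : Finset (Sym2 W))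
    (hA : ¬ (wiredGraph Λ A).Connected) : berezinIntegral Λ (∏ e ∈ A, zeta Λ e) = 0 := by
  classical
  set G := wiredGraph Λ A
  let C : Finset {v // v ∈ Λ} := Finset.univ.filter fun v => ¬ G.Reachable none (some v)
  have hC : C.Nonempty := by
    by_contra hC
    refine hA ((SimpleGraph.connected_iff_exists_forall_reachable G).2 ⟨none, ?_⟩)
    rintro (_ | v)
    · exact SimpleGraph.Reachable.refl _
    · by_contra hv
      exact hC ⟨v, by simp [C, hv]⟩
  let d : Letters Λ →ₗ[ℝ] ℝ := ∑ v ∈ C, LinearMap.proj (Sum.inl v)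
  have hd : ∀ x, d (wiredLetter Λ x) = if G.Reachable none x then 0 else 1 := by
    rintro (_ | v)
    · simp [wiredLetter]
    · simp [d, wiredLetter, letter, Pi.single_apply, C]
  have hdBar : ∀ x, d (wiredLetterBar Λ x) = 0 := by
    rintro (_ | v)
    · simp [wiredLetterBar]
    · simp [d, wiredLetterBar, letterBar]
  -- The orientation of the edges plays no role.
  have hz : ∀ e : Sym2 W, ∃ a b, zeta Λ e = pair Λ a b ∧ (e ∈ A → d a = 0) ∧ d b = 0 := by
    intro e
    induction e with | _ u w => ?_
    refine ⟨_, _, (zeta_eq_wiredZeta Λ _).trans (wiredZeta_mk Λ _ _), fun he => ?_, ?_⟩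
    · have : G.Reachable none (wire Λ w) ↔ G.Reachable none (wire Λ u) := by
        by_cases huw : wire Λ u = wire Λ w
        · rw [huw]
        · have hadj : G.Adj (wire Λ u) (wire Λ w) :=
            (SimpleGraph.fromEdgeSet_adj _).2 ⟨⟨s(u, w), he, rfl⟩, huw⟩
          exact ⟨fun h => h.trans hadj.symm.reachable, fun h => h.trans hadj.reachable⟩
      rw [map_sub, hd, hd]
      simp only [this, sub_self]
    · rw [map_sub, hdBar, hdBar, sub_zero]
  choose a b hab ha hb using hz
  rw [berezinIntegral_apply, berezin_eq_zero_of_sum_deriv Λ C hC, map_zero]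
  have := contractLeft_prod_pair Λ d A a b ha fun e _ => hb e
  simp only [d, map_sum, LinearMap.sum_apply] at this
  simp only [hab]
  exact this

theorem wiredLetter_mul_prod_density {D : Finset {v // v ∈ Λ}} {x : Option {v // v ∈ Λ}}
    (hx : x ∈ D.insertNone) (b : Letters Λ) :
    pair Λ (wiredLetter Λ x) b * ∏ v ∈ D, density Λ v = 0 := by
  rcases x with _ | v
  · simp [wiredLetter]
  · rw [← Finset.mul_prod_erase _ _ (Finset.some_mem_insertNone.1 hx), ← mul_assoc]
    simp [density, wiredLetter, pair_mul_pair_same_left]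

theorem wiredLetterBar_mul_prod_density {D : Finset {v // v ∈ Λ}} {x : Option {v // v ∈ Λ}}
    (hx : x ∈ D.insertNone) (a : Letters Λ) :
    pair Λ a (wiredLetterBar Λ x) * ∏ v ∈ D, density Λ v = 0 := by
  rcases x with _ | v
  · simp [wiredLetterBar]
  · rw [← Finset.mul_prod_erase _ _ (Finset.some_mem_insertNone.1 hx), ← mul_assoc]
    simp [density, wiredLetterBar, pair_mul_pair_same_right]

theorem wiredZeta_mul_prod_density {D : Finset {v // v ∈ Λ}} {x : Option {v // v ∈ Λ}}
    (hx : x ∈ D.insertNone) (v : {v // v ∈ Λ}) :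
    wiredZeta Λ s(x, some v) * ∏ v ∈ D, density Λ v = density Λ v * ∏ v ∈ D, density Λ v := by
  rw [wiredZeta_mk, pair_sub_right_mul, pair_sub_left_mul,
    wiredLetterBar_mul_prod_density Λ hx, wiredLetter_mul_prod_density Λ hx, sub_zero, sub_zero]
  rfl

/-- A connected edge set contains edge sets that explore the wired graph from the contracted
vertex, adding one new vertex with each edge. For these the product of the `ζ(e)` is the product
of the `ψ_v ψ̄_v` over the explored vertices: modulo the letters already explored, the new edge
from `x` to `v` contributes `(ψ_v - ψ_x) (ψ̄_v - ψ̄_x) = ψ_v ψ̄_v`. -/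
theorem exists_exploration (A : Finset (Sym2 W)) (hA : (wiredGraph Λ A).Connected) (m : ℕ)
    (hm : m ≤ Fintype.card {v // v ∈ Λ}) :
    ∃ D : Finset {v // v ∈ Λ}, ∃ F ⊆ A, D.card = m ∧ F.card = m ∧
      (∀ e ∈ F, ∀ x ∈ e.map (wire Λ), x ∈ D.insertNone) ∧
      ∏ e ∈ F, zeta Λ e = ∏ v ∈ D, density Λ v := by
  induction m with
  | zero => exact ⟨∅, ∅, by simp⟩
  | succ m ih =>
    obtain ⟨D, F, hFA, hD, hF, hFD, hprod⟩ := ih (by omega)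
    obtain ⟨w, hw⟩ : ∃ w, w ∉ D := by
      by_contra! h
      rw [Finset.eq_univ_iff_forall.2 h, Finset.card_univ] at hD
      omega
    obtain ⟨p⟩ := hA.preconnected none (some w)
    obtain ⟨⟨⟨x, y⟩, hxy⟩, -, hx, hy⟩ := p.exists_boundary_dart (D.insertNone : Set _)
      (by simp) (by simpa using hw)
    simp only [Finset.mem_coe] at hx hy
    obtain _ | v := y
    · simp at hy
    have hv : v ∉ D := by simpa using hy
    obtain ⟨e, he, hex⟩ := ((SimpleGraph.fromEdgeSet_adj _).1 hxy).1
    have heF : e ∉ F := fun h => hy (hFD e h _ (by rw [hex]; simp))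
    refine ⟨insert v D, insert e F, Finset.insert_subset he hFA, ?_, ?_, ?_, ?_⟩
    · rw [Finset.card_insert_of_notMem hv, hD]
    · rw [Finset.card_insert_of_notMem heF, hF]
    · have hsub : D.insertNone ⊆ (insert v D).insertNone :=
        Finset.insertNone.monotone (Finset.subset_insert v D)
      intro f hf z hz
      rcases Finset.mem_insert.1 hf with rfl | hf
      · rw [hex, Sym2.mem_iff] at hz
        rcases hz with rfl | rfl
        · exact hsub hx
        · simp
      · exact hsub (hFD f hf z hz)
    · rw [Finset.prod_insert heF, Finset.prod_insert hv, hprod, zeta_eq_wiredZeta, hex]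
      exact wiredZeta_mul_prod_density Λ hx v

/-- Every letter kills the product of all the letters. -/
theorem zeta_mul_prod_density_univ (e : Sym2 W) :
    zeta Λ e * ∏ v, density Λ v = 0 := by
  have h : ∀ x : Option {v // v ∈ Λ}, x ∈ (Finset.univ : Finset {v // v ∈ Λ}).insertNone := by
    rintro (_ | v) <;> simp
  rw [zeta_eq_wiredZeta]
  induction e.map (wire Λ) with | _ x y => ?_
  rw [wiredZeta_mk, pair_sub_left_mul,
    wiredLetter_mul_prod_density Λ (h _), wiredLetter_mul_prod_density Λ (h _), sub_zero]

variable (H : SimpleGraph W) [H.LocallyFinite]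

theorem not_isDiag_map_wire {e : Sym2 W} (he : e ∈ edges H Λ) : ¬ (e.map (wire Λ)).IsDiag := by
  induction e with | _ a b => ?_
  obtain ⟨hab, h⟩ := (mem_edges_mk Λ H).1 he
  rw [Sym2.map_mk, Sym2.mk_isDiag_iff]
  by_cases ha : a ∈ Λ <;> by_cases hb : b ∈ Λ <;> simp_all [wire, hab.ne]

theorem card_edgeSet_wiredGraph {A : Finset (Sym2 W)} (hA : A ⊆ edges H Λ) :
    Nat.card (wiredGraph Λ A).edgeSet = (A.image (Sym2.map (wire Λ))).card := by
  have : (wiredGraph Λ A).edgeSet = (A.image (Sym2.map (wire Λ)) : Finset _) := by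
    rw [SimpleGraph.edgeSet_fromEdgeSet, Finset.coe_image, sdiff_eq_left, Set.disjoint_left]
    rintro _ ⟨e, he, rfl⟩
    exact not_isDiag_map_wire Λ H (hA he)
  rw [this, Nat.card_coe_set_eq, Set.ncard_coe_finset]

/-- A connected edge set is a spanning tree exactly if it has as many edges as `Λ` has
vertices. -/
theorem isSpanningTree_iff_card {A : Finset (Sym2 W)} (hA : A ⊆ edges H Λ)
    (hc : (wiredGraph Λ A).Connected) :
    IsSpanningTree H Λ A ↔ A.card = Fintype.card {v // v ∈ Λ} := by
  have hcard := card_edgeSet_wiredGraph Λ H hA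
  have hle := Finset.card_image_le (s := A) (f := Sym2.map (wire Λ))
  have hn : Nat.card (Option {v // v ∈ Λ}) = Fintype.card {v // v ∈ Λ} + 1 := by
    rw [Nat.card_eq_fintype_card, Fintype.card_option]
  constructor
  · rintro ⟨-, hinj, htree⟩
    have h := (SimpleGraph.isTree_iff_connected_and_card.1 htree).2
    rw [hn, hcard, Finset.card_image_of_injOn hinj] at h
    omega
  · intro h
    have hge := hc.card_vert_le_card_edgeSet_add_one
    have heq : (A.image (Sym2.map (wire Λ))).card = A.card := by omega
    exact ⟨hA, Finset.card_image_iff.1 heq,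
      SimpleGraph.isTree_iff_connected_and_card.2 ⟨hc, by rw [hn, hcard, heq, h]⟩⟩

/-- The Berezin integral of a product of edge fields is the indicator of a spanning tree. -/
theorem berezinIntegral_prod_zeta {A : Finset (Sym2 W)} (hA : A ⊆ edges H Λ)
    [Decidable (IsSpanningTree H Λ A)] :
    berezinIntegral Λ (∏ e ∈ A, zeta Λ e) = if IsSpanningTree H Λ A then 1 else 0 := by
  by_cases hc : (wiredGraph Λ A).Connected
  · obtain ⟨D, F, hFA, hD, hF, -, hprod⟩ := exists_exploration Λ A hc _ le_rfl
    rw [Finset.card_eq_iff_eq_univ] at hD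
    subst hD
    by_cases hcard : A.card = Fintype.card {v // v ∈ Λ}
    · rw [if_pos ((isSpanningTree_iff_card Λ H hA hc).2 hcard),
        ← Finset.eq_of_subset_of_card_le hFA (by omega), hprod, berezinIntegral_prod_density]
    · rw [if_neg (mt (isSpanningTree_iff_card Λ H hA hc).1 hcard)]
      -- An edge of `A` outside `F` multiplies the top element.
      obtain ⟨e, he⟩ : (A \ F).Nonempty := by
        rw [Finset.sdiff_nonempty]
        intro h
        exact hcard (hF ▸ congrArg Finset.card (h.antisymm hFA))
      rw [← Finset.prod_sdiff hFA, hprod, ← Finset.prod_erase_mul _ _ he, mul_assoc,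
        zeta_mul_prod_density_univ, mul_zero, map_zero]
  · rw [berezinIntegral_prod_zeta_of_not_connected Λ A hc, if_neg fun h => hc h.2.2.connected]

end Trees

/-! ### Generating functions of the degrees -/

section Generating

variable {R α ι : Type*} [CommRing R] [DecidableEq α]

/-- The generating function of the sets `A ⊆ E` with prescribed numbers of elements in disjoint
parts of `E` factorizes. -/
theorem sum_prod_filter_card_inter [DecidableEq ι] (z : α → R) (k : ι → ℕ) (P : ι → Finset α)
    (V : Finset ι) (E : Finset α) (hd : (V : Set ι).PairwiseDisjoint P) (hP : ∀ v ∈ V, P v ⊆ E) :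
    ∑ A ∈ E.powerset with ∀ v ∈ V, (A ∩ P v).card = k v, ∏ e ∈ A, z e =
      (∏ e ∈ E \ V.biUnion P, (1 + z e)) *
        ∏ v ∈ V, ∑ S ∈ (P v).powersetCard (k v), ∏ e ∈ S, z e := by
  induction V using Finset.induction_on generalizing E with
  | empty => simp [Finset.prod_one_add]
  | insert a V ha ih =>
    have hda : ∀ v ∈ V, Disjoint (P v) (P a) := fun v hv =>
      hd (by simp [hv]) (by simp) fun h => ha (h ▸ hv)
    have hPa : P a ⊆ E := hP a (by simp)
    have hih := ih (E \ P a) (hd.subset (by simp)) fun v hv =>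
      Finset.subset_sdiff.2 ⟨hP v (by simp [hv]), hda v hv⟩
    have hE : E \ (insert a V).biUnion P = (E \ P a) \ V.biUnion P := by
      rw [Finset.biUnion_insert, sdiff_sdiff_left, Finset.sup_eq_union]
    rw [Finset.prod_insert ha, hE, mul_left_comm, ← hih, Finset.sum_mul_sum,
      ← Finset.sum_product']
    -- A set `A` is split into `A ∩ P a` and `A \ P a`.
    refine Finset.sum_bij' (fun A _ => (A ∩ P a, A \ P a)) (fun S _ => S.1 ∪ S.2) ?_ ?_ ?_ ?_ ?_
    · intro A hA
      simp only [Finset.mem_filter, Finset.mem_powerset, Finset.forall_mem_insert] at hA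
      simp only [Finset.mem_product, Finset.mem_powersetCard, Finset.mem_filter,
        Finset.mem_powerset]
      refine ⟨⟨Finset.inter_subset_right, hA.2.1⟩, Finset.sdiff_subset_sdiff hA.1 le_rfl,
        fun v hv => ?_⟩
      rw [← hA.2.2 v hv]
      congr 1
      ext e
      have : e ∈ P v → e ∉ P a := fun h => Finset.disjoint_left.1 (hda v hv) h
      simp only [Finset.mem_inter, Finset.mem_sdiff]
      tauto
    · rintro ⟨S, B⟩ h
      simp only [Finset.mem_product, Finset.mem_powersetCard, Finset.mem_filter,
        Finset.mem_powerset, Finset.subset_sdiff] at h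
      obtain ⟨⟨hS, hSk⟩, ⟨hBE, hBa⟩, hB⟩ := h
      simp only [Finset.mem_filter, Finset.mem_powerset, Finset.forall_mem_insert]
      refine ⟨Finset.union_subset (hS.trans hPa) hBE, ?_, fun v hv => ?_⟩
      · rw [Finset.union_inter_distrib_right, Finset.inter_eq_left.2 hS,
          Finset.disjoint_iff_inter_eq_empty.1 hBa, Finset.union_empty, hSk]
      · rw [Finset.union_inter_distrib_right, Finset.disjoint_iff_inter_eq_empty.1
          ((hda v hv).symm.mono_left hS), Finset.empty_union, hB v hv]
    · intro A _
      exact sup_inf_sdiff A (P a)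
    · rintro ⟨S, B⟩ h
      simp only [Finset.mem_product, Finset.mem_powersetCard, Finset.mem_filter,
        Finset.mem_powerset, Finset.subset_sdiff] at h
      obtain ⟨⟨hS, -⟩, ⟨-, hBa⟩, -⟩ := h
      refine Prod.ext ?_ ?_
      · simp only [Finset.union_inter_distrib_right, Finset.inter_eq_left.2 hS,
          Finset.disjoint_iff_inter_eq_empty.1 hBa, Finset.union_empty]
      · simp only [Finset.union_sdiff_distrib, Finset.sdiff_eq_empty_iff_subset.2 hS,
          Finset.sdiff_eq_self_of_disjoint hBa, Finset.empty_union]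
    · intro A _
      exact (Finset.prod_inter_mul_prod_sdiff A (P a) z).symm

/-- For square-zero `z`, the factors `1 - z(e)` cancel the factors `1 + z(e)`. -/
theorem prod_one_add_mul_prod_one_sub (z : α → R) (hz : ∀ e, z e * z e = 0) (P : ι → Finset α)
    (V : Finset ι) (E : Finset α) (hd : (V : Set ι).PairwiseDisjoint P) (hP : ∀ v ∈ V, P v ⊆ E)
    (X : ι → R) :
    (∏ e ∈ E, (1 + z e)) * ∏ v ∈ V, X v * ∏ e ∈ P v, (1 - z e) =
      (∏ e ∈ E \ V.biUnion P, (1 + z e)) * ∏ v ∈ V, X v := by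
  have h1 : (∏ e ∈ V.biUnion P, (1 + z e)) * ∏ e ∈ V.biUnion P, (1 - z e) = 1 := by
    rw [← Finset.prod_mul_distrib]
    refine Finset.prod_eq_one fun e _ => ?_
    linear_combination -hz e
  rw [Finset.prod_mul_distrib, ← Finset.prod_biUnion hd,
    ← Finset.prod_sdiff (Finset.biUnion_subset.2 hP)]
  linear_combination (∏ e ∈ E \ V.biUnion P, (1 + z e)) * (∏ v ∈ V, X v) * h1

end Generating

/-! ### The law of the degrees -/

section Law

variable {W : Type*} [DecidableEq W] (H : SimpleGraph W) [H.LocallyFinite] (Λ : Finset W)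

instance : MeasurableSingletonClass (SpanningTree H Λ) := ⟨fun _ => trivial⟩

theorem treeDegree_eq_card (T : SpanningTree H Λ) (v : W) :
    treeDegree H Λ T v = (T.1 ∩ edgesAt H Λ v).card := by
  rw [treeDegree, Finset.sum_boole, Nat.cast_id, Finset.filter_mem_eq_inter, Finset.inter_comm]

theorem edgesAt_pairwiseDisjoint {V : Finset W} (hV : IsGoodSet H V) :
    (V : Set W).PairwiseDisjoint (edgesAt H Λ) := by
  intro u hu v hv huv
  refine Finset.disjoint_left.2 fun e he he' => ?_
  have h1 := Finset.mem_filter.1 he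
  have h2 := (Finset.mem_filter.1 he').2
  rw [(Sym2.mem_and_mem_iff huv).1 ⟨h1.2, h2⟩, mem_edges_mk] at h1
  exact hV u hu v hv h1.1.1

open Classical in
/-- The Berezin integral counts spanning trees with prescribed degrees at a good set. -/
theorem berezinIntegral_eq_card [DecidableRel H.Adj] {V : Finset W} (hV : IsGoodSet H V)
    (k : W → ℕ) :
    berezinIntegral Λ ((∏ e ∈ edges H Λ, (1 + zeta Λ e)) *
        ∏ v ∈ V, fieldX H Λ (k v) v * fieldY H Λ v) =
      Nat.card {T : SpanningTree H Λ | ∀ v ∈ V, treeDegree H Λ T v = k v} := by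
  have hd := edgesAt_pairwiseDisjoint H Λ hV
  have hP : ∀ v ∈ V, edgesAt H Λ v ⊆ edges H Λ := fun v _ => Finset.filter_subset _ _
  have h := (prod_one_add_mul_prod_one_sub (zeta Λ) (zeta_mul_self Λ) (edgesAt H Λ) V
    (edges H Λ) hd hP fun v => fieldX H Λ (k v) v).trans
      (sum_prod_filter_card_inter (zeta Λ) k (edgesAt H Λ) V (edges H Λ) hd hP).symm
  refine (congrArg (berezinIntegral Λ) h).trans ?_
  rw [map_sum, Finset.sum_congr rfl fun A hA => berezinIntegral_prod_zeta Λ H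
    (Finset.mem_powerset.1 (Finset.mem_filter.1 hA).1), Finset.sum_boole, Nat.cast_inj,
    Nat.card_coe_set_eq,
    ← Set.ncard_image_of_injective _ (f := fun T : SpanningTree H Λ => T.1) Subtype.val_injective,
    ← Set.ncard_coe_finset]
  congr 1
  ext A
  simp only [Finset.coe_filter, Finset.mem_filter, Finset.mem_powerset, Set.mem_ofPred_eq,
    Set.mem_image]
  constructor
  · rintro ⟨⟨-, h⟩, hA⟩
    exact ⟨⟨A, hA⟩, fun v hv => (treeDegree_eq_card H Λ _ v).trans (h v hv), rfl⟩
  · rintro ⟨T, h, rfl⟩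
    exact ⟨⟨T.2.1, fun v hv => (treeDegree_eq_card H Λ T v).symm.trans (h v hv)⟩, T.2⟩

theorem ust_real (s : Set (SpanningTree H Λ)) :
    (ust H Λ).real s = (Nat.card (SpanningTree H Λ) : ℝ)⁻¹ * Nat.card s := by
  have := Fintype.ofFinite (SpanningTree H Λ)
  rw [MeasureTheory.measureReal_def, ust, ProbabilityTheory.uniformOn_univ,
    MeasureTheory.Measure.count_apply s.toFinite.measurableSet, ← s.toFinite.cast_ncard_eq,
    ENat.toENNReal_coe, ENNReal.toReal_div, ENNReal.toReal_natCast, ENNReal.toReal_natCast,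
    Nat.card_coe_set_eq, Nat.card_eq_fintype_card, div_eq_inv_mul]

theorem integral_prod_degreeIndicator (V : Finset W) (k : W → ℕ) :
    ∫ T, ∏ v ∈ V, degreeIndicator H Λ v (k v) T ∂(ust H Λ) =
      (ust H Λ).real {T | ∀ v ∈ V, treeDegree H Λ T v = k v} := by
  rw [← MeasureTheory.integral_indicator_one (Set.toFinite _).measurableSet]
  refine MeasureTheory.integral_congr_ae (.of_forall fun T => ?_)
  simp only [degreeIndicator, Finset.prod_boole, Set.indicator_apply, Set.mem_ofPred_eq,
    Pi.one_apply]

end Law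

end FermionicUST

theorem mainTheorem1 {W : Type*} [DecidableEq W] (H : SimpleGraph W) [H.LocallyFinite]
    [DecidableRel H.Adj] (Λ : Finset W)
    (hΛ : ∀ v ∈ Λ, ∃ w, w ∉ Λ ∧ H.Reachable v w)
    (V : Finset W) (hV : FermionicUST.IsGoodSet H V)
    (k : W → ℕ)
    (hk : ∀ v ∈ V, k v ∈ Finset.Icc 1 (FermionicUST.edgesAt H Λ v).card) :
    (FermionicUST.ust H Λ).real {T | ∀ v ∈ V, FermionicUST.treeDegree H Λ T v = k v} =
        ∫ T, ∏ v ∈ V, FermionicUST.degreeIndicator H Λ v (k v) T ∂(FermionicUST.ust H Λ) ∧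
      ∫ T, ∏ v ∈ V, FermionicUST.degreeIndicator H Λ v (k v) T ∂(FermionicUST.ust H Λ) =
        FermionicUST.fgff H Λ
          ((∏ v ∈ V, FermionicUST.fieldX H Λ (k v) v * FermionicUST.fieldY H Λ v :
            Subalgebra.center ℝ (FermionicUST.Grassmann Λ)) : FermionicUST.Grassmann Λ) := by
  have hcount := FermionicUST.berezinIntegral_eq_card H Λ hV k
  -- With no prescribed degree the same count yields the normalization, the number of all trees.
  have htotal := FermionicUST.berezinIntegral_eq_card H Λ (V := ∅)
    (by simp [FermionicUST.IsGoodSet]) k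
  have huniv : {T : FermionicUST.SpanningTree H Λ |
      ∀ v ∈ (∅ : Finset W), FermionicUST.treeDegree H Λ T v = k v} = Set.univ := by simp
  rw [huniv, Nat.card_univ, Finset.prod_empty, mul_one] at htotal
  rw [FermionicUST.integral_prod_degreeIndicator, FermionicUST.fgff_coe, hcount, htotal]
  exact ⟨rfl, FermionicUST.ust_real H Λ _⟩
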